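/- Let $F$ be a field, let $a_0, a_1, \ldots$ and $b_0, b_1, \ldots$ be two sequences of (algebraically independent) indeterminates over $F$, and let $R = F[a_0, a_1, \ldots, b_0, b_1, \ldots]$ be the polynomial ring in all of them. For a power series $h \in R[[X]]$, let the content $c(h)$ be the ideal of $R$ generated by the coefficients of $h$. Let $f = \sum_{i=0}^\infty a_i X^i$ and $g = \sum_{i=0}^\infty b_i X^i$ in $R[[X]]$. Then $R$ is not Noetherian, and there is no integer $k \ge 1$ such that \[ c(f)^k\, c(g) = c(f)^{k-1}\, c(fg). \] -/

import Mathlib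

/-- The content `c(h)` of a power series `h` over `R`: the ideal of `R` generated by the
coefficients of `h`. -/
def PowerSeries.contentIdeal {R : Type*} [CommRing R] (h : PowerSeries R) : Ideal R :=
  Ideal.span (Set.range fun n : ℕ => PowerSeries.coeff n h)

/-- The polynomial ring `F[a₀, a₁, …, b₀, b₁, …]` in two sequences of indeterminates. -/
abbrev TwoSeqRing (F : Type*) [Field F] : Type _ := MvPolynomial (ℕ ⊕ ℕ) F

/-- The indeterminate `aᵢ`. -/
noncomputable def TwoSeqRing.a (F : Type*) [Field F] (i : ℕ) : TwoSeqRing F :=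
  MvPolynomial.X (Sum.inl i)

/-- The indeterminate `bᵢ`. -/
noncomputable def TwoSeqRing.b (F : Type*) [Field F] (i : ℕ) : TwoSeqRing F :=
  MvPolynomial.X (Sum.inr i)

/-- The generic power series `f = ∑ aᵢ Xⁱ`. -/
noncomputable def genericF (F : Type*) [Field F] : PowerSeries (TwoSeqRing F) :=
  PowerSeries.mk (TwoSeqRing.a F)

/-- The generic power series `g = ∑ bᵢ Xⁱ`. -/
noncomputable def genericG (F : Type*) [Field F] : PowerSeries (TwoSeqRing F) :=
  PowerSeries.mk (TwoSeqRing.b F)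

/-!
The pair `(f, g)` is universal: any two power series `p`, `q` over an `R`-algebra are the images of
`f`, `g` under a substitution of the indeterminates. Hence an inclusion `c(f)ᵏ c(g) ⊆ c(fg)` would
hold for every such pair. It fails for `p = xX - y` and `q = ∑_{i ≤ k} xⁱ yᵏ⁻ⁱ Xⁱ` over `R[x, y]`:
the product is `xᵏ⁺¹ Xᵏ⁺¹ - yᵏ⁺¹`, whereas `c(p)ᵏ c(q)` contains `xᵏ yᵏ`, which is not in
`(xᵏ⁺¹, yᵏ⁺¹)`.

The ring is not Noetherian because finitely many indeterminates do not generate the ideal of all of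
them.
-/

section Ideals

open MvPolynomial

theorem not_fg_idealOfVars {σ R : Type*} [CommSemiring R] [Nontrivial R] [Infinite σ] :
    ¬ (idealOfVars σ R).FG := by
  intro hfg
  obtain ⟨s, hs, hspan⟩ := (Submodule.fg_span_iff_fg_span_finset_subset _).1 hfg
  obtain ⟨i, hi⟩ := (s.finite_toSet.preimage (X_injective (R := R)).injOn).exists_notMem
  have hX : (X i : MvPolynomial σ R) ∈ Ideal.span (X '' (X ⁻¹' (s : Set (MvPolynomial σ R)))) := by
    rw [Set.image_preimage_eq_of_subset hs, Ideal.span, ← hspan]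
    exact Ideal.subset_span (Set.mem_range_self i)
  obtain ⟨j, hj, hne⟩ := mem_ideal_span_X_image.1 hX (Finsupp.single i 1) (by simp [support_X])
  exact hi ((Finsupp.single_apply_ne_zero.1 hne).1 ▸ hj)

theorem not_isNoetherianRing_mvPolynomial {σ R : Type*} [CommSemiring R] [Nontrivial R]
    [Infinite σ] : ¬ IsNoetherianRing (MvPolynomial σ R) :=
  fun h => not_fg_idealOfVars ((isNoetherianRing_iff_ideal_fg _).1 h (idealOfVars σ R))

theorem X_pow_mul_X_pow_notMem_span {σ R : Type*} [CommSemiring R] [Nontrivial R] {i j : σ}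
    (hij : i ≠ j) (m n : ℕ) :
    (X i ^ m * X j ^ n : MvPolynomial σ R) ∉ Ideal.span {X i ^ (m + 1), X j ^ (n + 1)} := by
  have hspan : ({X i ^ (m + 1), X j ^ (n + 1)} : Set (MvPolynomial σ R)) =
      (fun s => monomial s (1 : R)) '' {Finsupp.single i (m + 1), Finsupp.single j (n + 1)} := by
    simp only [Set.image_pair, X_pow_eq_monomial]
  classical
  rw [hspan, mem_ideal_span_monomial_image]
  intro h
  obtain ⟨s, hs, hle⟩ := h (Finsupp.single i m + Finsupp.single j n)
    (by simp [X_pow_eq_monomial, monomial_mul, coeff_monomial])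
  rcases hs with rfl | rfl
  · simpa [hij] using hle i
  · simpa [hij.symm] using hle j

end Ideals

section Content

open PowerSeries

variable {R S : Type*} [CommRing R] [CommRing S]

theorem coeff_mem_contentIdeal (h : R⟦X⟧) (n : ℕ) : coeff n h ∈ h.contentIdeal :=
  Ideal.subset_span (Set.mem_range_self n)

theorem contentIdeal_map (φ : R →+* S) (h : R⟦X⟧) :
    (h.map φ).contentIdeal = h.contentIdeal.map φ := by
  simp only [contentIdeal, Ideal.map_span, ← Set.range_comp, Function.comp_def,
    PowerSeries.coeff_map]

theorem contentIdeal_map_pow_mul_le {f g : R⟦X⟧} {k : ℕ} (φ : R →+* S)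
    (h : f.contentIdeal ^ k * g.contentIdeal ≤ (f * g).contentIdeal) :
    (f.map φ).contentIdeal ^ k * (g.map φ).contentIdeal ≤ (f.map φ * g.map φ).contentIdeal := by
  simpa only [← map_mul, contentIdeal_map, Ideal.map_mul, Ideal.map_pow] using
    Ideal.map_mono (f := φ) h

/-- The power series `∑ vᵢ Xⁱ` whose coefficients are the indeterminates named by `v`; the pair
given by `Sum.inl` and `Sum.inr` is `genericF`, `genericG` over any commutative ring. -/
noncomputable def genericSeries (R : Type*) [CommRing R] {σ : Type*} (v : ℕ → σ) :
    (MvPolynomial σ R)⟦X⟧ :=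
  mk fun i => MvPolynomial.X (v i)

theorem contentIdeal_pow_mul_le_of_generic [Algebra R S] {k : ℕ}
    (h : (genericSeries R Sum.inl).contentIdeal ^ k * (genericSeries R Sum.inr).contentIdeal ≤
      (genericSeries R (Sum.inl : ℕ → ℕ ⊕ ℕ) * genericSeries R Sum.inr).contentIdeal)
    (p q : S⟦X⟧) :
    p.contentIdeal ^ k * q.contentIdeal ≤ (p * q).contentIdeal := by
  let φ : MvPolynomial (ℕ ⊕ ℕ) R →+* S :=
    MvPolynomial.eval₂Hom (algebraMap R S) (Sum.elim (fun i => coeff i p) (fun i => coeff i q))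
  have hp : (genericSeries R Sum.inl).map φ = p := by
    ext n
    simp [φ, genericSeries]
  have hq : (genericSeries R Sum.inr).map φ = q := by
    ext n
    simp [φ, genericSeries]
  rw [← hp, ← hq]
  exact contentIdeal_map_pow_mul_le φ h

/-- The homogeneous geometric sum `∑_{i ≤ k} xⁱ yᵏ⁻ⁱ Xⁱ`, the cofactor of `xX - y` in
`xᵏ⁺¹ Xᵏ⁺¹ - yᵏ⁺¹`. -/
noncomputable def homogeneousGeomSum (x y : R) (k : ℕ) : R⟦X⟧ :=
  ∑ i ∈ Finset.range (k + 1), (C x * X) ^ i * C y ^ (k - i)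

theorem linear_mul_homogeneousGeomSum (x y : R) (k : ℕ) :
    (C x * X - C y) * homogeneousGeomSum x y k =
      C (x ^ (k + 1)) * X ^ (k + 1) - C (y ^ (k + 1)) := by
  rw [map_pow, map_pow, ← mul_pow, ← (Commute.all _ _).mul_geom_sum₂]
  rfl

theorem contentIdeal_linear_mul_homogeneousGeomSum_le (x y : R) (k : ℕ) :
    ((C x * X - C y) * homogeneousGeomSum x y k).contentIdeal ≤
      Ideal.span {x ^ (k + 1), y ^ (k + 1)} := by
  refine Ideal.span_le.2 (Set.range_subset_iff.2 fun n => ?_)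
  rw [linear_mul_homogeneousGeomSum, map_sub, coeff_C_mul_X_pow, coeff_C]
  refine sub_mem ?_ ?_ <;> split_ifs
  exacts [Ideal.subset_span (.inl rfl), zero_mem _, Ideal.subset_span (.inr rfl), zero_mem _]

theorem left_mem_contentIdeal_linear (x y : R) : x ∈ (C x * X - C y).contentIdeal := by
  have hmem := coeff_mem_contentIdeal (C x * X - C y) 1
  rwa [map_sub, coeff_C_mul, coeff_one_X, coeff_C, if_neg one_ne_zero, mul_one, sub_zero] at hmem

theorem right_pow_mem_contentIdeal_homogeneousGeomSum (x y : R) (k : ℕ) :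
    y ^ k ∈ (homogeneousGeomSum x y k).contentIdeal := by
  simpa [homogeneousGeomSum, Finset.sum_range_succ'] using
    coeff_mem_contentIdeal (homogeneousGeomSum x y k) 0

theorem pow_mul_pow_mem_span_pow_succ_of_contentIdeal_le {x y : R} {k : ℕ}
    (h : (C x * X - C y).contentIdeal ^ k * (homogeneousGeomSum x y k).contentIdeal ≤
      ((C x * X - C y) * homogeneousGeomSum x y k).contentIdeal) :
    x ^ k * y ^ k ∈ Ideal.span {x ^ (k + 1), y ^ (k + 1)} :=
  contentIdeal_linear_mul_homogeneousGeomSum_le x y k <| h <|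
    Ideal.mul_mem_mul (Ideal.pow_mem_pow (left_mem_contentIdeal_linear x y) k)
      (right_pow_mem_contentIdeal_homogeneousGeomSum x y k)

end Content

theorem mainTheorem5_general (R : Type*) [CommRing R] [Nontrivial R] :
    ¬ IsNoetherianRing (MvPolynomial (ℕ ⊕ ℕ) R) ∧
    ∀ k : ℕ, ¬ (genericSeries R Sum.inl).contentIdeal ^ k *
        (genericSeries R Sum.inr).contentIdeal ≤
      (genericSeries R (Sum.inl : ℕ → ℕ ⊕ ℕ) * genericSeries R Sum.inr).contentIdeal := by
  refine ⟨not_isNoetherianRing_mvPolynomial, fun k hle => ?_⟩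
  let x : MvPolynomial (Fin 2) R := MvPolynomial.X 0
  let y : MvPolynomial (Fin 2) R := MvPolynomial.X 1
  have hxy : x ^ k * y ^ k ∈ Ideal.span {x ^ (k + 1), y ^ (k + 1)} :=
    pow_mul_pow_mem_span_pow_succ_of_contentIdeal_le (contentIdeal_pow_mul_le_of_generic hle _ _)
  exact X_pow_mul_X_pow_notMem_span zero_ne_one k k hxy

theorem mainTheorem5 (F : Type*) [Field F] :
    ¬ IsNoetherianRing (TwoSeqRing F) ∧
    ¬ ∃ k : ℕ, 1 ≤ k ∧
      (genericF F).contentIdeal ^ k * (genericG F).contentIdeal =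
        (genericF F).contentIdeal ^ (k - 1) * (genericF F * genericG F).contentIdeal := by
  obtain ⟨hNoeth, hcontent⟩ := mainTheorem5_general F
  exact ⟨hNoeth, fun ⟨k, _, hk⟩ => hcontent k (hk.trans_le Ideal.mul_le_right)⟩
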